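/- **Conventions.** Let $S^2$ be the unit sphere in $\mathbb{R}^3$ with its standard orientation and the Euclidean metric, let $\mathbb{D}\subset\mathbb{C}$ be the open unit disk and $S^1=\partial\mathbb{D}$. A map $f\colon S^2\to S^2$ is an *(orientation-preserving) branched cover* if for each $v\in S^2$ there are an integer $q\ge 1$ (the *local degree* of $f$ at $v$), open neighborhoods $V$ of $v$ and $W$ of $f(v)$ with $f(V)\subseteq W$, and orientation-preserving homeomorphisms $\varphi\colon V\to\mathbb{D}$, $\psi\colon W\to\mathbb{D}$ with $\varphi(v)=0$ and $\psi(f(v))=0$, such that $\psi\circ f\circ\varphi^{-1}(z)=z^q$ for all $z\in\mathbb{D}$. The set $\operatorname{crit}(f)$ of *critical points* consists of the points of local degree at least $2$, and $\operatorname{post}(f)=\bigcup_{n\ge 1}\{f^n(c): c\in\operatorname{crit}(f)\}$, where $f^n$ is the $n$-th iterate. The *degree* $\deg f$ is the number of preimages of a generic point, that is, the largest number of preimages of a point of $S^2$. A *Thurston map* is a branched cover $f\colon S^2\to S^2$ such that $\operatorname{post}(f)$ is finite and $\#\operatorname{post}(f)\ge 3$. A Thurston map $f$ is *expanding* if there is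 a Jordan curve $\mathcal{C}\subset S^2$ with $\operatorname{post}(f)\subseteq\mathcal{C}$ such that the maximal diameter of a connected component of $S^2\setminus f^{-n}(\mathcal{C})$ tends to $0$ as $n\to\infty$ (for a Thurston map this property does not depend on the choice of such a curve $\mathcal{C}$). **Theorem 1.2.** Let $f\colon S^2\to S^2$ be a Thurston map. Suppose that for some $n\ge 1$ the iterate $F=f^n$ admits a Peano curve, i.e. a continuous surjective map $\gamma\colon S^1\to S^2$, such that $F(\gamma(z))=\gamma(z^d)$ for all $z\in S^1$, where $d=\deg F$. Then $f$ is expanding. -/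

import Mathlib

open Set Filter Topology

noncomputable section

/-- The sphere `S²`, the unit sphere of Euclidean 3-space with the Euclidean metric. -/
abbrev S2 : Type := Metric.sphere (0 : EuclideanSpace ℝ (Fin 3)) 1

/-! ### Orientation -/

/-- `(p, u, v)` is a positively oriented orthonormal basis of Euclidean 3-space. For `p ∈ S²` this
says that `(u, v)` is a positively oriented orthonormal basis of the tangent plane of `S²` at `p`,
where `S²` carries its standard orientation as the boundary of the ball. -/
structure IsPosFrame (p u v : EuclideanSpace ℝ (Fin 3)) : Prop where
  orthonormal : Orthonormal ℝ ![p, u, v]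
  det_pos : 0 < (Matrix.of fun i j => (![p, u, v] i) j).det

theorem IsPosFrame.norm_circle {p u v : EuclideanSpace ℝ (Fin 3)} (h : IsPosFrame p u v)
    (r t : ℝ) :
    ‖Real.cos r • p + Real.sin r • (Real.cos t • u + Real.sin t • v)‖ = 1 := by
  have ho := orthonormal_iff_ite.1 h.orthonormal
  have hpp : inner ℝ p p = 1 := by simpa using ho 0 0
  have huu : inner ℝ u u = 1 := by simpa using ho 1 1
  have hvv : inner ℝ v v = 1 := by simpa using ho 2 2
  have hpu : inner ℝ p u = 0 := by simpa using ho 0 1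
  have hpv : inner ℝ p v = 0 := by simpa using ho 0 2
  have huv : inner ℝ u v = 0 := by simpa using ho 1 2
  have hup : inner ℝ u p = 0 := by simpa using ho 1 0
  have hvp : inner ℝ v p = 0 := by simpa using ho 2 0
  have hvu : inner ℝ v u = 0 := by simpa using ho 2 1
  have key : ‖Real.cos r • p + Real.sin r • (Real.cos t • u + Real.sin t • v)‖ ^ 2 = 1 := by
    rw [← real_inner_self_eq_norm_sq]
    simp only [inner_add_left, inner_add_right, real_inner_smul_left, real_inner_smul_right,
      hpp, huu, hvv, hpu, hpv, huv, hup, hvp, hvu]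
    linear_combination Real.sin_sq_add_cos_sq r
      + Real.sin r ^ 2 * Real.sin_sq_add_cos_sq t
  exact (pow_eq_one_iff_of_nonneg (norm_nonneg _) two_ne_zero).1 key

/-- The circle on `S²` with centre `p` and spherical radius `r`, run through in the positive sense:
`t ↦ cos r · p + sin r · (cos t · u + sin t · v)` for a positive frame `(p, u, v)`. -/
def sphericalCircle {p u v : EuclideanSpace ℝ (Fin 3)} (h : IsPosFrame p u v) (r t : ℝ) : S2 :=
  ⟨Real.cos r • p + Real.sin r • (Real.cos t • u + Real.sin t • v),
    mem_sphere_zero_iff_norm.2 (h.norm_circle r t)⟩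

/-- The `2π`-periodic curve `c` avoids `0` and has winding number `1` about `0`: it has a
continuous argument `θ` which increases by `2π` over each period. -/
def WindsOnce (c : ℝ → ℂ) : Prop :=
  (∀ t, c t ≠ 0) ∧
    ∃ θ : ℝ → ℝ, Continuous θ ∧
      (∀ t, c t = (‖c t‖ : ℂ) * Complex.exp ((θ t : ℂ) * Complex.I)) ∧
      ∀ t, θ (t + 2 * Real.pi) = θ t + 2 * Real.pi

/-- A homeomorphism `φ` from an open subset of `S²` onto an open subset of `ℂ` preserves
orientation: around each point `p` of its domain, the images of all sufficiently small positively
oriented circles about `p` wind once, in the positive sense, about `φ p`. -/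
def OrientationPreserving (φ : OpenPartialHomeomorph S2 ℂ) : Prop :=
  ∀ p ∈ φ.source, ∀ (u v : EuclideanSpace ℝ (Fin 3)) (h : IsPosFrame p u v),
    ∀ᶠ r in 𝓝[>] (0 : ℝ), WindsOnce fun t => φ (sphericalCircle h r t) - φ p

/-- `φ` is an orientation-preserving homeomorphism from an open neighbourhood of `v` in `S²` onto
the open unit disk, with `φ v = 0`. -/
structure IsDiskChartAt (φ : OpenPartialHomeomorph S2 ℂ) (v : S2) : Prop where
  mem_source : v ∈ φ.source
  target_eq : φ.target = Metric.ball 0 1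
  map_zero : φ v = 0
  orientationPreserving : OrientationPreserving φ

/-! ### Branched covers and Thurston maps -/

/-- `f` has local degree `q ≥ 1` at `v`: after orientation-preserving homeomorphic changes of
coordinates `φ : V → 𝔻` near `v` and `ψ : W → 𝔻` near `f v`, the map `f : V → W` is `z ↦ z ^ q`
on the unit disk `𝔻`. -/
def HasLocalDegree (f : S2 → S2) (v : S2) (q : ℕ) : Prop :=
  1 ≤ q ∧ ∃ φ ψ : OpenPartialHomeomorph S2 ℂ,
    IsDiskChartAt φ v ∧ IsDiskChartAt ψ (f v) ∧ MapsTo f φ.source ψ.source ∧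
      ∀ z ∈ Metric.ball (0 : ℂ) 1, ψ (f (φ.symm z)) = z ^ q

/-- An orientation-preserving branched cover of the sphere. -/
def IsBranchedCover (f : S2 → S2) : Prop :=
  ∀ v, ∃ q, HasLocalDegree f v q

/-- The set of critical points: the points of local degree at least `2`. -/
def crit (f : S2 → S2) : Set S2 :=
  {c | ∃ q, 2 ≤ q ∧ HasLocalDegree f c q}

/-- The set of postcritical points `f^n(c)`, with `n ≥ 1` and `c` critical. -/
def post (f : S2 → S2) : Set S2 :=
  {x | ∃ n, 1 ≤ n ∧ ∃ c ∈ crit f, f^[n] c = x}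

/-- A Thurston map: an orientation-preserving, postcritically finite branched cover of the sphere.
As usual, at least three postcritical points are required. -/
structure IsThurstonMap (f : S2 → S2) : Prop where
  isBranchedCover : IsBranchedCover f
  finite_post : (post f).Finite
  three_le_card_post : 3 ≤ (post f).ncard

/-- The degree of a branched cover of the sphere: the number of preimages of a generic point. Every
point has at most `deg f` preimages, and exactly `deg f` if it is not the image of a critical point,
so this is the largest number of preimages of a point. -/
def degree (f : S2 → S2) : ℕ :=
  ⨆ w : S2, (f ⁻¹' {w}).ncard

/-! ### Expansion -/

/-- A Jordan curve in the sphere: the image of an injective continuous map of the circle. -/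
def IsJordanCurve (C : Set S2) : Prop :=
  ∃ c : Circle → S2, Continuous c ∧ Function.Injective c ∧ range c = C

/-- The largest diameter of a connected component of `S² ∖ A`. -/
def mesh (A : Set S2) : ℝ :=
  ⨆ x : ↥(Aᶜ), Metric.diam (connectedComponentIn Aᶜ (x : S2))

/-- A Thurston map `f` is expanding if there is a Jordan curve `C` containing all postcritical
points such that the largest diameter of a component of `S² ∖ f⁻ⁿ(C)` tends to `0` as `n → ∞`.
For a Thurston map this property does not depend on the choice of such a curve `C`. -/
def IsExpanding (f : S2 → S2) : Prop :=
  ∃ C : Set S2, IsJordanCurve C ∧ post f ⊆ C ∧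
    Tendsto (fun n : ℕ => mesh (f^[n] ⁻¹' C)) atTop (𝓝 0)

end

/-!
The Peano curve provides short arcs whose iterated images are large but controlled. Write
`g u = γ (exp (i u))`. If `m = s + n k` with `s < n`, then `f^[m] (g u) = σ (d ^ k u)` for the curve
`σ = f^[s] ∘ g`, so an arc of `g` of length about `d ^ (-k)`, which has small diameter, is mapped
by `f^[m]` onto an arc of `σ` of bounded length. Since `σ` is periodic, finitely many spherical
caps `U w`, whose number `N` does not depend on `k`, cover `σ`; each is centred at a point
`σ w` and contains no postcritical point except possibly its centre. As `γ` is surjective, every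
point `x` of the sphere is joined, by a short arc of `g` over some `U w`, to a preimage of the
centre `σ w` under `f^[m]`.

Let now `r` be a connected set that `f^[m]` maps into a convex region `Ω` without postcritical
points. For each of the `N` caps, all points of `r` that use this cap are joined to the same
preimage of its centre (`center_unique`). Hence `N` balls of small radius cover `r`, and since `r` is
connected its diameter is at most `N` times theirs (`dist_le_of_finite_caps`). Letting `k` tend to
infinity shows that such sets `r` shrink uniformly (`eventually_dist_le`).

The uniqueness of the preimage rests on `eq_of_isPreconnected_over_convex`: a connected set over
a convex region `B` that meets the postcritical set at most in `y` contains at most one preimage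
of `y`. Indeed `f^[m]` is a covering away from the postcritical set, so that the contraction of `B`
towards `y` lifts to the preimage of `B`. The lift is continuous, fixes the preimages of `y`, and
moves the connected set into a small neighbourhood of this finite set.

A homeomorphism of the sphere, composed of a rotation and a rotation by an angle that depends on the
latitude, moves the postcritical set to a great circle (`exists_homeomorph_great_circle`). After
conjugation by it, the Jordan curve in the definition of expansion is this great circle, and the
two components of its complement are hemispheres, to which `eventually_dist_le` applies. It needs
`2 ≤ d`, which holds because a map with a critical point is not injective.
-/

/-! ### Radial projection and spherical segments -/

/-- Euclidean 3-space. -/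
abbrev E3 : Type := EuclideanSpace ℝ (Fin 3)

/-- The radial projection `v ↦ v / ‖v‖` of Euclidean 3-space onto the sphere. At `v = 0` it takes
an arbitrary value. -/
noncomputable def radial (v : E3) : S2 :=
  if h : v = 0 then ⟨EuclideanSpace.single 0 1, by simp⟩
  else ⟨‖v‖⁻¹ • v, by simp [norm_smul, h]⟩

theorem coe_radial {v : E3} (hv : v ≠ 0) : (radial v : E3) = ‖v‖⁻¹ • v := by
  simp [radial, hv]

theorem radial_coe (x : S2) : radial x = x := by
  have hx : ‖(x : E3)‖ = 1 := by simp
  have h0 : (x : E3) ≠ 0 := by rw [← norm_ne_zero_iff, hx]; exact one_ne_zero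
  apply Subtype.ext
  rw [coe_radial h0, hx, inv_one, one_smul]

theorem continuousOn_radial : ContinuousOn radial {0}ᶜ := by
  rw [Topology.IsInducing.subtypeVal.continuousOn_iff]
  have : ContinuousOn (fun v : E3 => ‖v‖⁻¹ • v) {0}ᶜ :=
    (continuousOn_id.norm.inv₀ fun v hv => norm_ne_zero_iff.2 hv).smul continuousOn_id
  exact this.congr fun v hv => coe_radial hv

theorem radial_mem {Q : ConvexCone ℝ E3} {v : E3} (h0 : (0 : E3) ∉ Q) (hv : v ∈ Q) :
    (radial v : E3) ∈ Q := by
  have hne : v ≠ 0 := fun h => h0 (h ▸ hv)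
  rw [coe_radial hne]
  exact Q.smul_mem (inv_pos.2 (norm_pos_iff.2 hne)) hv

theorem dist_radial_le {v : E3} (hv : v ≠ 0) (y : S2) :
    dist (radial v) y ≤ 2 * ‖v - y‖ := by
  have hy : ‖(y : E3)‖ = 1 := by simp
  have h1 : ‖‖v‖⁻¹ • v - v‖ = |1 - ‖v‖| := by
    have : ‖v‖⁻¹ • v - v = (‖v‖⁻¹ * (1 - ‖v‖)) • v := by
      rw [mul_sub, mul_one, inv_mul_cancel₀ (norm_ne_zero_iff.2 hv), sub_smul, one_smul]
    rw [this, norm_smul, norm_mul, norm_inv, norm_norm, Real.norm_eq_abs, mul_right_comm,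
      inv_mul_cancel₀ (norm_ne_zero_iff.2 hv), one_mul]
  have h2 : |1 - ‖v‖| ≤ ‖v - y‖ := by
    have := abs_norm_sub_norm_le (y : E3) v
    rwa [hy, norm_sub_rev] at this
  rw [Subtype.dist_eq, coe_radial hv, dist_eq_norm]
  calc ‖‖v‖⁻¹ • v - y‖ ≤ ‖‖v‖⁻¹ • v - v‖ + ‖v - y‖ := norm_sub_le_norm_sub_add_norm_sub _ _ _
    _ ≤ 2 * ‖v - y‖ := by linarith

/-- The point at time `t` on the spherical segment from `b` to `y`: the radial projection of
`(1 - t) b + t y`. It is meaningful for `b ≠ -y`. -/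
noncomputable def sphSegment (b y : S2) (t : ℝ) : S2 :=
  radial ((1 - t) • (b : E3) + t • (y : E3))

@[simp] theorem sphSegment_zero (b y : S2) : sphSegment b y 0 = b := by
  simp [sphSegment, radial_coe]

@[simp] theorem sphSegment_one (b y : S2) : sphSegment b y 1 = y := by
  simp [sphSegment, radial_coe]

@[simp] theorem sphSegment_self (y : S2) (t : ℝ) : sphSegment y y t = y := by
  simp [sphSegment, ← add_smul, radial_coe]

section Cone

variable {Q : ConvexCone ℝ E3} {b y : S2} {t : ℝ}

theorem segment_mem (hb : (b : E3) ∈ Q) (hy : (y : E3) ∈ Q) (ht : t ∈ Icc (0 : ℝ) 1) :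
    (1 - t) • (b : E3) + t • (y : E3) ∈ Q :=
  Q.convex hb hy (sub_nonneg.2 ht.2) ht.1 (by ring)

theorem sphSegment_mem (h0 : (0 : E3) ∉ Q) (hb : (b : E3) ∈ Q) (hy : (y : E3) ∈ Q)
    (ht : t ∈ Icc (0 : ℝ) 1) : (sphSegment b y t : E3) ∈ Q :=
  radial_mem h0 (segment_mem hb hy ht)

theorem dist_sphSegment_le (h0 : (0 : E3) ∉ Q) (hb : (b : E3) ∈ Q) (hy : (y : E3) ∈ Q)
    (ht : t ∈ Icc (0 : ℝ) 1) : dist (sphSegment b y t) y ≤ 2 * (1 - t) * dist b y := by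
  have hne : (1 - t) • (b : E3) + t • (y : E3) ≠ 0 := fun h =>
    h0 (h ▸ segment_mem hb hy ht)
  refine (dist_radial_le hne y).trans (le_of_eq ?_)
  have : (1 - t) • (b : E3) + t • (y : E3) - y = (1 - t) • ((b : E3) - y) := by module
  rw [this, norm_smul, Real.norm_of_nonneg (sub_nonneg.2 ht.2), Subtype.dist_eq, dist_eq_norm]
  ring

theorem sphSegment_ne (h0 : (0 : E3) ∉ Q) (hb : (b : E3) ∈ Q) (hy : (y : E3) ∈ Q)
    (hne : b ≠ y) (ht : t ∈ Ico (0 : ℝ) 1) : sphSegment b y t ≠ y := by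
  intro h
  set v := (1 - t) • (b : E3) + t • (y : E3) with hv
  have hvQ : v ∈ Q := segment_mem hb hy (Ico_subset_Icc_self ht)
  have hv0 : v ≠ 0 := fun h => h0 (h ▸ hvQ)
  have hvn : 0 < ‖v‖ := norm_pos_iff.2 hv0
  have h1 : ‖v‖⁻¹ • v = y := by rw [← coe_radial hv0]; exact congrArg Subtype.val h
  have h2 : v = ‖v‖ • (y : E3) := by rw [← h1, smul_smul, mul_inv_cancel₀ hvn.ne', one_smul]
  have h1t : 0 < 1 - t := sub_pos.2 ht.2
  have h3 : (b : E3) = ((‖v‖ - t) / (1 - t)) • (y : E3) := by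
    have : (1 - t) • (b : E3) = (‖v‖ - t) • (y : E3) := by
      rw [sub_smul ‖v‖, ← h2, hv]; abel
    rw [div_eq_inv_mul, mul_smul, ← this, smul_smul, inv_mul_cancel₀ h1t.ne', one_smul]
  set c := (‖v‖ - t) / (1 - t)
  have hc : |c| = 1 := by
    have : ‖(b : E3)‖ = ‖c • (y : E3)‖ := congrArg _ h3
    simpa [norm_smul] using this.symm
  rcases (abs_eq zero_le_one).1 hc with hc | hc
  · exact hne (Subtype.ext (by rw [h3, hc, one_smul]))
  · refine h0 ?_
    have := Q.add_mem hb hy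
    rwa [h3, hc, neg_one_smul, neg_add_cancel] at this

end Cone

theorem continuousOn_sphSegment (y : S2) :
    ContinuousOn (fun q : S2 × ℝ => sphSegment q.1 y q.2)
      {q | (1 - q.2) • (q.1 : E3) + q.2 • (y : E3) ≠ 0} :=
  continuousOn_radial.comp (by fun_prop) fun _ h => h

/-- The open circular cone `{v | c ‖v‖ < ⟪y, v⟫}` about the axis `y`. For `0 ≤ c` it is convex, and
it meets the sphere in a spherical cap centred at `y`, for a unit vector `y`. -/
def capCone (y : E3) (c : ℝ) (hc : 0 ≤ c) : ConvexCone ℝ E3 where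
  carrier := {v | c * ‖v‖ < inner ℝ y v}
  smul_mem' r hr v hv := by
    simp only [mem_ofPred_eq, norm_smul, real_inner_smul_right, Real.norm_of_nonneg hr.le] at hv ⊢
    nlinarith
  add_mem' v hv w hw := by
    simp only [mem_ofPred_eq, inner_add_right] at hv hw ⊢
    nlinarith [norm_add_le v w]

/-- The open half-space on which the linear functional `l` is positive. -/
def posCone (l : E3 →L[ℝ] ℝ) : ConvexCone ℝ E3 where
  carrier := {v | 0 < l v}
  smul_mem' r hr v hv := by
    simp only [mem_ofPred_eq, map_smul, smul_eq_mul] at hv ⊢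
    positivity
  add_mem' v hv w hw := by
    simp only [mem_ofPred_eq, map_add] at hv hw ⊢
    positivity

theorem mem_capCone {y v : E3} {c : ℝ} {hc : 0 ≤ c} :
    v ∈ capCone y c hc ↔ c * ‖v‖ < inner ℝ y v := Iff.rfl

theorem mem_posCone {l : E3 →L[ℝ] ℝ} {v : E3} : v ∈ posCone l ↔ 0 < l v := Iff.rfl

theorem zero_notMem_capCone {y : E3} {c : ℝ} {hc : 0 ≤ c} : (0 : E3) ∉ capCone y c hc := by
  simp [mem_capCone]

theorem zero_notMem_posCone {l : E3 →L[ℝ] ℝ} : (0 : E3) ∉ posCone l := by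
  simp [mem_posCone]

theorem isOpen_setOf_mem_capCone {y : E3} {c : ℝ} {hc : 0 ≤ c} :
    IsOpen {x : S2 | (x : E3) ∈ capCone y c hc} := by
  simp only [mem_capCone]
  exact isOpen_lt (by fun_prop) (by fun_prop)

/-- Around each point of the sphere there is a spherical cap that meets a given finite set at most
in its centre. -/
theorem exists_capCone {P : Set S2} (hP : P.Finite) (y : S2) :
    ∃ c : ℝ, ∃ hc : 0 ≤ c, (y : E3) ∈ capCone y c hc ∧
      ∀ b : S2, (b : E3) ∈ capCone y c hc → b ∈ P → b = y := by
  have h1 : ∀ b : S2, b ≠ y → inner ℝ (y : E3) (b : E3) < 1 := fun b hb =>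
    inner_lt_one_iff_real_of_norm_eq_one (by simp) (by simp) |>.2 fun h => hb (Subtype.ext h.symm)
  have hev : ∀ᶠ c : ℝ in 𝓝[<] 1, 0 ≤ c ∧ c < 1 ∧
      ∀ b ∈ P, b ≠ y → inner ℝ (y : E3) (b : E3) ≤ c := by
    refine ((eventually_ge_nhds zero_lt_one).filter_mono nhdsWithin_le_nhds).and
      (Eventually.and self_mem_nhdsWithin ?_)
    refine (hP.eventually_all).2 fun b _ => ?_
    by_cases hb : b = y
    · exact Eventually.of_forall fun c h => absurd hb h
    · exact ((eventually_ge_nhds (h1 b hb)).filter_mono nhdsWithin_le_nhds).mono fun c h _ => h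
  obtain ⟨c, hc0, hc1, hc⟩ := hev.exists
  refine ⟨c, hc0, by simpa [mem_capCone] using hc1, fun b hb hbP => ?_⟩
  by_contra hne
  have := hc b hbP hne
  rw [mem_capCone] at hb
  simp only [norm_eq_of_mem_sphere, mul_one] at hb
  linarith

/-! ### Lifting contractions through branched covers -/

theorem exists_separation_of_finite_fiber {p : S2 → S2} (hp : Continuous p) {x : S2}
    (hfin : (p ⁻¹' {p x}).Finite) {O : Set S2} (hO : O ∈ 𝓝 x) :
    ∃ O₁ O₂ : Set S2, IsOpen O₁ ∧ IsOpen O₂ ∧ Disjoint O₁ O₂ ∧ x ∈ O₁ ∧ O₁ ⊆ O ∧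
      p ⁻¹' {p x} \ {x} ⊆ O₂ ∧ ∃ δ > 0, p ⁻¹' Metric.ball (p x) δ ⊆ O₁ ∪ O₂ := by
  obtain ⟨u, v, hu, hv, hxu, hfv, huv⟩ := SeparatedNhds.of_finite (X := S2)
    (finite_singleton x) (hfin.subset (sdiff_subset (t := {x}))) disjoint_sdiff_self_right
  obtain ⟨w, hwO, hw, hxw⟩ := mem_nhds_iff.1 hO
  refine ⟨u ∩ w, v, hu.inter hw, hv, huv.mono_left inter_subset_left,
    ⟨hxu rfl, hxw⟩, fun z hz => hwO hz.2, hfv, ?_⟩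
  have hopen : IsOpen (u ∩ w ∪ v) := (hu.inter hw).union hv
  have hclosed : IsClosed (p '' (u ∩ w ∪ v)ᶜ) := hp.isClosedMap _ hopen.isClosed_compl
  have hmem : p x ∈ (p '' (u ∩ w ∪ v)ᶜ)ᶜ := by
    rintro ⟨z, hz, hzx⟩
    by_cases h : z = x
    · exact hz (Or.inl (h ▸ ⟨hxu rfl, hxw⟩))
    · exact hz (Or.inr (hfv ⟨hzx, h⟩))
  obtain ⟨δ, hδ, hball⟩ := Metric.isOpen_iff.1 hclosed.isOpen_compl _ hmem
  refine ⟨δ, hδ, fun z hz => ?_⟩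
  by_contra h
  exact hball hz ⟨z, h, rfl⟩

/-- Over a convex region about `y` that meets `P` at most in `y`, the segments from points `b ≠ y`
towards `y`, cut off at time `T < 1`, lift simultaneously and continuously through a map that is a
covering over the complement of `P`. -/
theorem exists_lift_segments {p : S2 → S2} {P : Set S2} (hp : Continuous p)
    (hloc : IsLocalHomeomorphOn p (p ⁻¹' Pᶜ)) {Q : ConvexCone ℝ E3} (h0 : (0 : E3) ∉ Q)
    {y : S2} (hy : (y : E3) ∈ Q) (hP : ∀ b : S2, (b : E3) ∈ Q → b ∈ P → b = y)
    {T : ℝ} (hT : T ∈ Ico (0 : ℝ) 1) :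
    ∃ L : unitInterval × {x : S2 // (p x : E3) ∈ Q ∧ p x ≠ y} → S2, Continuous L ∧
      (∀ a, L (0, a) = a) ∧ ∀ t a, p (L (t, a)) = sphSegment (p a) y (T * t) := by
  have cov : IsCoveringMap (Pᶜ.restrictPreimage p) :=
    (IsCoveringMapOn.of_isLocalHomeomorphOn hp hloc).isCoveringMap_restrictPreimage
  have hTt : ∀ t : unitInterval, T * t ∈ Ico (0 : ℝ) 1 := fun t =>
    ⟨mul_nonneg hT.1 t.2.1, (mul_le_of_le_one_right hT.1 t.2.2).trans_lt hT.2⟩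
  let F : C({x : S2 // (p x : E3) ∈ Q ∧ p x ≠ y}, p ⁻¹' Pᶜ) :=
    ⟨fun x => ⟨x, fun h => x.2.2 (hP _ x.2.1 h)⟩, by fun_prop⟩
  have hc : Continuous fun q : unitInterval × {x : S2 // (p x : E3) ∈ Q ∧ p x ≠ y} =>
      sphSegment (p q.2) y (T * q.1) :=
    (continuousOn_sphSegment y).comp_continuous
      (f := fun q : unitInterval × {x : S2 // (p x : E3) ∈ Q ∧ p x ≠ y} =>
        (p q.2, T * (q.1 : ℝ))) (by fun_prop) fun q h =>
        h0 (h ▸ segment_mem q.2.2.1 hy (Ico_subset_Icc_self (hTt q.1)))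
  let H : C(unitInterval × {x : S2 // (p x : E3) ∈ Q ∧ p x ≠ y}, ↥(Pᶜ)) :=
    ⟨fun q => ⟨sphSegment (p q.2) y (T * q.1), fun h =>
        sphSegment_ne h0 q.2.2.1 hy q.2.2.2 (hTt q.1)
          (hP _ (sphSegment_mem h0 q.2.2.1 hy (Ico_subset_Icc_self (hTt q.1))) h)⟩,
      hc.subtype_mk _⟩
  have H0 : ∀ a, H (0, a) = Pᶜ.restrictPreimage p (F a) := fun a => by
    apply Subtype.ext
    simp [H, F]
  refine ⟨fun q => cov.liftHomotopy H F H0 q,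
    continuous_subtype_val.comp (cov.liftHomotopy H F H0).continuous, fun a => ?_, fun t a => ?_⟩
  · exact congrArg Subtype.val (cov.liftHomotopy_zero H F H0 a)
  · exact congrArg Subtype.val (congrFun (cov.liftHomotopy_lifts H F H0) (t, a))

/-- The partial contraction `b ↦ sphSegment b y T` of a convex region about `y` lifts through a map
that is a covering away from `y`, and the lift fixes the fibre of `y`. -/
theorem exists_lift_contraction {p : S2 → S2} {P : Set S2} (hp : Continuous p)
    (hloc : IsLocalHomeomorphOn p (p ⁻¹' Pᶜ)) {Q : ConvexCone ℝ E3} (h0 : (0 : E3) ∉ Q)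
    {y : S2} (hy : (y : E3) ∈ Q) (hP : ∀ b : S2, (b : E3) ∈ Q → b ∈ P → b = y)
    (hfin : (p ⁻¹' {y}).Finite) {T : ℝ} (hT : T ∈ Ico (0 : ℝ) 1) :
    ∃ g : S2 → S2, ContinuousOn g (p ⁻¹' {b | (b : E3) ∈ Q}) ∧ (∀ x, p x = y → g x = x) ∧
      ∀ x, (p x : E3) ∈ Q → p (g x) = sphSegment (p x) y T := by
  classical
  have hTt : ∀ t : unitInterval, T * t ∈ Ico (0 : ℝ) 1 := fun t =>
    ⟨mul_nonneg hT.1 t.2.1, (mul_le_of_le_one_right hT.1 t.2.2).trans_lt hT.2⟩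
  obtain ⟨L, hL, L0, pL⟩ := exists_lift_segments hp hloc h0 hy hP hT
  obtain ⟨g, gA, gy⟩ : ∃ g : S2 → S2,
      (∀ x (h : (p x : E3) ∈ Q ∧ p x ≠ y), g x = L (1, ⟨x, h⟩)) ∧ ∀ x, p x = y → g x = x :=
    ⟨fun x => if h : (p x : E3) ∈ Q ∧ p x ≠ y then L (1, ⟨x, h⟩) else x,
      fun x h => dif_pos h, fun x h => dif_neg fun hA => hA.2 h⟩
  refine ⟨g, fun x hx => ?_, gy, fun x hx => ?_⟩
  · by_cases hxy : p x = y
    · rw [ContinuousWithinAt, gy x hxy]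
      refine fun O hO => ?_
      subst hxy
      obtain ⟨O₁, O₂, hO₁, hO₂, hd, hx₁, hsub, -, δ, hδ, hball⟩ :=
        exists_separation_of_finite_fiber hp hfin hO
      have hN : O₁ ∩ p ⁻¹' Metric.ball (p x) (δ / 2) ∈ 𝓝 x :=
        inter_mem (hO₁.mem_nhds hx₁)
          (hp.continuousAt.preimage_mem_nhds (Metric.ball_mem_nhds _ (half_pos hδ)))
      change ∀ᶠ z in 𝓝[_] x, g z ∈ O
      filter_upwards [self_mem_nhdsWithin, mem_nhdsWithin_of_mem_nhds hN] with z hzQ hz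
      refine hsub ?_
      by_cases hzy : p z = p x
      · rw [gy z hzy]; exact hz.1
      · have hzA : (p z : E3) ∈ Q ∧ p z ≠ p x := ⟨hzQ, hzy⟩
        rw [gA z hzA]
        have hpre : IsPreconnected (range fun t => L (t, ⟨z, hzA⟩)) :=
          isPreconnected_range (by fun_prop)
        have hz0 : z ∈ range fun t => L (t, ⟨z, hzA⟩) := ⟨0, L0 ⟨z, hzA⟩⟩
        refine hpre.subset_left_of_subset_union hO₁ hO₂ hd ?_ ⟨z, hz0, hz.1⟩ ⟨1, rfl⟩
        rintro _ ⟨t, rfl⟩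
        refine hball ?_
        rw [mem_preimage, pL, Metric.mem_ball]
        refine (dist_sphSegment_le h0 hzA.1 hy (Ico_subset_Icc_self (hTt t))).trans_lt ?_
        have h1 : dist (p z) (p x) < δ / 2 := hz.2
        have h2 := (hTt t).1
        have h3 : 0 ≤ dist (p z) (p x) := dist_nonneg
        nlinarith
    · have hA : ContinuousOn g {x | (p x : E3) ∈ Q ∧ p x ≠ y} := by
        rw [continuousOn_iff_continuous_domRestrict]
        exact (hL.comp (Continuous.prodMk_right 1)).congr fun a => (gA a a.2).symm
      refine (hA x ⟨hx, hxy⟩).mono_of_mem_nhdsWithin ?_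
      have : {z | p z ≠ y} ∈ 𝓝 x := (isOpen_ne_fun hp continuous_const).mem_nhds hxy
      filter_upwards [self_mem_nhdsWithin, mem_nhdsWithin_of_mem_nhds this] with z h1 h2
      exact ⟨h1, h2⟩
  · by_cases hxy : p x = y
    · rw [gy x hxy, hxy, sphSegment_self]
    · rw [gA x ⟨hx, hxy⟩, pL]; simp

/-- Let `p` be a covering over the complement of `P`, and let the convex region cut out by `Q`
meet `P` at most in `y`. Then a connected set over this region contains at most one preimage of
`y`: contracting towards `y` moves the set close to the fibre of `y`, and fixes the fibre. -/
theorem eq_of_isPreconnected_over_convex {p : S2 → S2} {P : Set S2} (hp : Continuous p)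
    (hloc : IsLocalHomeomorphOn p (p ⁻¹' Pᶜ)) {Q : ConvexCone ℝ E3} (h0 : (0 : E3) ∉ Q)
    {y : S2} (hy : (y : E3) ∈ Q) (hP : ∀ b : S2, (b : E3) ∈ Q → b ∈ P → b = y)
    (hfin : (p ⁻¹' {y}).Finite) {V : Set S2} (hV : IsPreconnected V)
    (hVQ : ∀ x ∈ V, (p x : E3) ∈ Q) {x₁ x₂ : S2} (h₁ : x₁ ∈ V) (h₂ : x₂ ∈ V)
    (hx₁ : p x₁ = y) (hx₂ : p x₂ = y) : x₁ = x₂ := by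
  by_contra hne
  subst hx₁
  obtain ⟨O₁, O₂, hO₁, hO₂, hd, hxO, -, hO, δ, hδ, hball⟩ :=
    exists_separation_of_finite_fiber hp hfin univ_mem
  obtain ⟨T, hT0, hT1, hTδ⟩ : ∃ T : ℝ, 0 ≤ T ∧ T < 1 ∧ 2 * (1 - T) * 2 < δ := by
    rcases le_or_gt δ 4 with h | h
    · exact ⟨1 - δ / 5, by linarith, by linarith, by linarith⟩
    · exact ⟨0, le_rfl, one_pos, by linarith⟩
  obtain ⟨g, hg, gy, pg⟩ := exists_lift_contraction hp hloc h0 hy hP hfin ⟨hT0, hT1⟩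
  have hpre : IsPreconnected (g '' V) := hV.image g (hg.mono hVQ)
  have hsub : g '' V ⊆ O₁ ∪ O₂ := by
    rintro _ ⟨x, hx, rfl⟩
    refine hball ?_
    rw [mem_preimage, pg x (hVQ x hx), Metric.mem_ball]
    refine (dist_sphSegment_le h0 (hVQ x hx) hy ⟨hT0, hT1.le⟩).trans_lt ?_
    have h2 : dist (p x) (p x₁) ≤ 2 := by
      rw [Subtype.dist_eq, dist_eq_norm]
      refine (norm_sub_le _ _).trans ?_
      simp only [norm_eq_of_mem_sphere]
      norm_num
    have : 2 * (1 - T) * dist (p x) (p x₁) ≤ 2 * (1 - T) * 2 :=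
      mul_le_mul_of_nonneg_left h2 (by linarith)
    linarith
  have h3 := hpre.subset_left_of_subset_union hO₁ hO₂ hd hsub
    ⟨x₁, ⟨x₁, h₁, gy _ rfl⟩, hxO⟩ ⟨x₂, h₂, gy _ hx₂⟩
  exact hd.ne_of_mem h3 (hO ⟨hx₂, Ne.symm hne⟩) rfl

/-- Path lifting over a convex region that avoids `P`: every point over the region can be joined,
over the region, to a preimage of a given point of the region. -/
theorem exists_isPreconnected_over_convex {p : S2 → S2} {P : Set S2} (hp : Continuous p)
    (hloc : IsLocalHomeomorphOn p (p ⁻¹' Pᶜ)) {Q : ConvexCone ℝ E3} (h0 : (0 : E3) ∉ Q)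
    (hP : ∀ b : S2, (b : E3) ∈ Q → b ∉ P) {y : S2} (hy : (y : E3) ∈ Q) {x : S2}
    (hx : (p x : E3) ∈ Q) :
    ∃ W : Set S2, IsPreconnected W ∧ (∀ w ∈ W, (p w : E3) ∈ Q) ∧ x ∈ W ∧ ∃ z ∈ W, p z = y := by
  have cov : IsCoveringMap (Pᶜ.restrictPreimage p) :=
    (IsCoveringMapOn.of_isLocalHomeomorphOn hp hloc).isCoveringMap_restrictPreimage
  let c : C(unitInterval, ↥(Pᶜ)) :=
    ⟨fun t => ⟨sphSegment (p x) y t, hP _ (sphSegment_mem h0 hx hy t.2)⟩, by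
      refine Continuous.subtype_mk ?_ _
      exact (continuousOn_sphSegment y).comp_continuous
        (f := fun t : unitInterval => (p x, (t : ℝ))) (by fun_prop) fun t h =>
          h0 (h ▸ segment_mem hx hy t.2)⟩
  obtain ⟨Γ, hΓ, hΓ0⟩ := cov.exists_path_lifts c ⟨x, hP _ hx⟩
    (Subtype.ext (by simp [c]))
  have pΓ : ∀ t, p (Γ t) = sphSegment (p x) y t := fun t =>
    congrArg Subtype.val (congrFun hΓ t)
  refine ⟨range fun t => (Γ t : S2), isPreconnected_range (by fun_prop), ?_,
    ⟨0, congrArg Subtype.val hΓ0⟩, _, ⟨1, rfl⟩, by simp [pΓ]⟩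
  rintro _ ⟨t, rfl⟩
  rw [pΓ]
  exact sphSegment_mem h0 hx hy t.2

/-- Let `r` be a connected set over a convex region `Ω` that avoids `P`, and let the convex region
`U` meet `P` at most in its centre `y`. If two points of `r` are joined over `U` to preimages of
`y`, then these preimages agree. -/
theorem center_unique {p : S2 → S2} {P : Set S2} (hp : Continuous p)
    (hloc : IsLocalHomeomorphOn p (p ⁻¹' Pᶜ)) (hfin : ∀ y, (p ⁻¹' {y}).Finite)
    {Ω U : ConvexCone ℝ E3} (hΩ0 : (0 : E3) ∉ Ω) (hU0 : (0 : E3) ∉ U)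
    (hΩP : ∀ b : S2, (b : E3) ∈ Ω → b ∉ P) {y : S2} (hy : (y : E3) ∈ U)
    (hUP : ∀ b : S2, (b : E3) ∈ U → b ∈ P → b = y)
    {r : Set S2} (hr : IsPreconnected r) (hrΩ : ∀ x ∈ r, (p x : E3) ∈ Ω)
    {x₁ x₂ c₁ c₂ : S2} (hx₁ : x₁ ∈ r) (hx₂ : x₂ ∈ r) {S₁ S₂ : Set S2}
    (hS₁ : IsPreconnected S₁) (hS₂ : IsPreconnected S₂)
    (hSU₁ : ∀ x ∈ S₁, (p x : E3) ∈ U) (hSU₂ : ∀ x ∈ S₂, (p x : E3) ∈ U)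
    (hxS₁ : x₁ ∈ S₁) (hxS₂ : x₂ ∈ S₂) (hcS₁ : c₁ ∈ S₁) (hcS₂ : c₂ ∈ S₂)
    (hc₁ : p c₁ = y) (hc₂ : p c₂ = y) : c₁ = c₂ := by
  obtain ⟨W, hW, hWQ, hxW, z, hzW, hz⟩ := exists_isPreconnected_over_convex hp hloc
    (Q := Ω ⊓ U) (fun h => hΩ0 h.1) (fun b hb => hΩP b hb.1) (y := p x₁)
    ⟨hrΩ _ hx₁, hSU₁ _ hxS₁⟩ (x := x₂) ⟨hrΩ _ hx₂, hSU₂ _ hxS₂⟩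
  have hxz : x₁ = z := by
    refine eq_of_isPreconnected_over_convex hp hloc hΩ0 (hrΩ _ hx₁)
      (fun b hb hbP => absurd hbP (hΩP b hb)) (hfin _) (hr.union x₂ hx₂ hxW hW) ?_
      (Or.inl hx₁) (Or.inr hzW) rfl hz
    rintro x (hx | hx)
    exacts [hrΩ x hx, (hWQ x hx).1]
  refine eq_of_isPreconnected_over_convex hp hloc hU0 hy hUP (hfin _)
    ((hS₁.union x₁ hxS₁ (hxz ▸ hzW) hW).union x₂ (Or.inr hxW) hxS₂ hS₂) ?_
    (Or.inl (Or.inl hcS₁)) (Or.inr hcS₂) hc₁ hc₂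
  rintro x ((hx | hx) | hx)
  exacts [hSU₁ x hx, (hWQ x hx).2, hSU₂ x hx]

/-! ### Shadowing by arcs of the Peano curve -/

theorem IsPreconnected.dist_le_of_subset_biUnion_closedBall {X ι : Type*} [PseudoMetricSpace X]
    {S : Set X} (hS : IsPreconnected S) {t : Finset ι} {c : ι → X} {ε : ℝ}
    (hcov : S ⊆ ⋃ i ∈ t, Metric.closedBall (c i) ε) {x y : X} (hx : x ∈ S) (hy : y ∈ S) :
    dist x y ≤ t.card * (2 * ε) := by
  have hε : 0 ≤ ε := by
    obtain ⟨i, -, hi⟩ := mem_iUnion₂.1 (hcov hx)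
    exact Metric.nonneg_of_mem_closedBall hi
  -- the values of `dist x` on `S` fill `[0, dist x y]` and are covered by intervals of length `2 ε`
  have hsub : Icc 0 (dist x y) ⊆ ⋃ i ∈ t, Metric.closedBall (dist x (c i)) ε := by
    have himg : IsPreconnected (dist x '' S) := hS.image _ (by fun_prop)
    refine (himg.ordConnected.out ⟨x, hx, dist_self x⟩ ⟨y, hy, rfl⟩).trans ?_
    rintro _ ⟨z, hz, rfl⟩
    obtain ⟨i, hi, hz⟩ := mem_iUnion₂.1 (hcov hz)
    refine mem_iUnion₂.2 ⟨i, hi, ?_⟩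
    rw [Metric.mem_closedBall, dist_comm x, dist_comm x]
    exact (dist_dist_dist_le_left z (c i) x).trans hz
  have hvol : ENNReal.ofReal (dist x y) ≤ ENNReal.ofReal (t.card * (2 * ε)) :=
    calc ENNReal.ofReal (dist x y) = MeasureTheory.volume (Icc 0 (dist x y)) := by simp
      _ ≤ ∑ i ∈ t, MeasureTheory.volume (Metric.closedBall (dist x (c i)) ε) :=
        (MeasureTheory.measure_mono hsub).trans (MeasureTheory.measure_biUnion_finset_le _ _)
      _ = ENNReal.ofReal (t.card * (2 * ε)) := by
        simp [Real.volume_closedBall, ENNReal.ofReal_mul]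
  exact (ENNReal.ofReal_le_ofReal_iff (by positivity)).1 hvol

/-- A compact stretch of a curve `σ` in the sphere is covered by finitely many spherical caps, each
centred at a point of the curve and meeting the finite set `P` at most in its centre. -/
theorem exists_finite_caps {σ : ℝ → S2} (hσ : Continuous σ) {P : Set S2} (hP : P.Finite) (l : ℝ) :
    ∃ (t : Finset ℝ) (U : ℝ → ConvexCone ℝ E3),
      (∀ w, (0 : E3) ∉ U w ∧ (σ w : E3) ∈ U w ∧
        ∀ b : S2, (b : E3) ∈ U w → b ∈ P → b = σ w) ∧
      ∀ τ ∈ Icc 0 l, ∃ w ∈ t, |w - τ| ≤ 1 ∧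
        ∀ a ∈ Icc (0 : ℝ) 1, (σ (τ + a * (w - τ)) : E3) ∈ U w := by
  choose c hc hmem hcP using exists_capCone hP
  have hball : ∀ w, ∃ δ > 0, δ ≤ 1 ∧
      Metric.ball w δ ⊆ σ ⁻¹' {x | (x : E3) ∈ capCone (σ w) (c (σ w)) (hc (σ w))} := fun w => by
    obtain ⟨δ, hδ, h⟩ := Metric.isOpen_iff.1
      ((isOpen_setOf_mem_capCone (y := (σ w : E3)) (hc := hc (σ w))).preimage hσ) w (hmem (σ w))
    exact ⟨min δ 1, lt_min hδ one_pos, min_le_right _ _,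
      (Metric.ball_subset_ball (min_le_left _ _)).trans h⟩
  choose δ hδ hδ1 hball using hball
  obtain ⟨t, -, ht⟩ := isCompact_Icc.elim_nhds_subcover (fun w => Metric.ball w (δ w))
    fun w (_ : w ∈ Icc 0 l) => Metric.ball_mem_nhds w (hδ w)
  refine ⟨t, fun w => capCone (σ w) (c (σ w)) (hc (σ w)),
    fun w => ⟨zero_notMem_capCone, hmem _, hcP _⟩, fun τ hτ => ?_⟩
  obtain ⟨w, hw, hτw⟩ := mem_iUnion₂.1 (ht hτ)
  refine ⟨w, hw, ?_, fun a ha => hball w ?_⟩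
  · rw [abs_sub_comm]
    exact (Metric.mem_ball.1 hτw).le.trans (hδ1 w)
  · have h := (convex_ball w (δ w)) hτw (Metric.mem_ball_self (hδ w)) (sub_nonneg.2 ha.2) ha.1
      (by ring)
    simp only [smul_eq_mul] at h
    convert h using 1
    ring

/-- Suppose that `p (g u) = σ (D u)` for a surjective curve `g` whose arcs of length `1 / D` have
diameter at most `ε`, and that `N` caps as in `exists_finite_caps` cover the periodic curve `σ`. Then
a connected set `r` over a convex region `Ω` has diameter at most `2 ε N`. Each point of `r` is
`ε`-close to a preimage of the centre of one of the caps, and by `center_unique` only one preimage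
occurs for each cap. -/
theorem dist_le_of_finite_caps {p : S2 → S2} {P : Set S2} (hp : Continuous p)
    (hloc : IsLocalHomeomorphOn p (p ⁻¹' Pᶜ)) (hfin : ∀ y, (p ⁻¹' {y}).Finite)
    {g σ : ℝ → S2} (hg : Continuous g) (hg_onto : Function.Surjective g) {D l : ℝ} (hD : 0 < D)
    (hl : 0 < l) (hσ : Function.Periodic σ l) (hpg : ∀ u, p (g u) = σ (D * u))
    {t : Finset ℝ} {U : ℝ → ConvexCone ℝ E3}
    (hU : ∀ w, (0 : E3) ∉ U w ∧ (σ w : E3) ∈ U w ∧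
      ∀ b : S2, (b : E3) ∈ U w → b ∈ P → b = σ w)
    (htU : ∀ τ ∈ Icc 0 l, ∃ w ∈ t, |w - τ| ≤ 1 ∧
      ∀ a ∈ Icc (0 : ℝ) 1, (σ (τ + a * (w - τ)) : E3) ∈ U w)
    {ε : ℝ} (hε : ∀ u u', |u' - u| ≤ 1 / D → dist (g u) (g u') ≤ ε)
    {Ω : ConvexCone ℝ E3} (hΩ0 : (0 : E3) ∉ Ω) (hΩP : ∀ b : S2, (b : E3) ∈ Ω → b ∉ P)
    {r : Set S2} (hr : IsPreconnected r) (hrΩ : ∀ x ∈ r, (p x : E3) ∈ Ω)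
    {x y : S2} (hx : x ∈ r) (hy : y ∈ r) : dist x y ≤ t.card * (2 * ε) := by
  -- `R x w c`: the point `x` is `ε`-close to, and joined over `U w` to, the preimage `c` of `σ w`
  let R : S2 → ℝ → S2 → Prop := fun x w c => dist x c ≤ ε ∧ p c = σ w ∧
    ∃ S : Set S2, IsPreconnected S ∧ (∀ z ∈ S, (p z : E3) ∈ U w) ∧ x ∈ S ∧ c ∈ S
  have hex : ∀ x, ∃ w ∈ t, ∃ c, R x w c := fun x => by
    obtain ⟨u, rfl⟩ := hg_onto x
    obtain ⟨j, τ, hτ, hτu⟩ : ∃ (j : ℤ) (τ : ℝ), τ ∈ Icc 0 l ∧ D * u = τ + j * l :=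
      ⟨toIcoDiv hl 0 (D * u), toIcoMod hl 0 (D * u),
        by simpa using Ico_subset_Icc_self (toIcoMod_mem_Ico hl 0 (D * u)),
        by rw [← zsmul_eq_mul, toIcoMod_add_toIcoDiv_zsmul]⟩
    obtain ⟨w, hw, hwτ, hcap⟩ := htU τ hτ
    have hpa : ∀ a, p (g (u + a * ((w - τ) / D))) = σ (τ + a * (w - τ)) := fun a => by
      rw [hpg, ← (hσ.int_mul j) (τ + a * (w - τ))]
      congr 1
      rw [mul_add, hτu]
      field_simp
      ring
    refine ⟨w, hw, g (u + 1 * ((w - τ) / D)), hε _ _ ?_, ?_,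
      (fun a => g (u + a * ((w - τ) / D))) '' Icc 0 1,
      isPreconnected_Icc.image _ (by fun_prop), ?_, ⟨0, by simp, by simp⟩, ⟨1, by simp, rfl⟩⟩
    · rw [add_sub_cancel_left, one_mul, abs_div, abs_of_pos hD]
      gcongr
    · rw [hpa]; congr 1; ring
    · rintro _ ⟨a, ha, rfl⟩
      simpa only [hpa] using hcap a ha
  have hcenter : ∀ w, ∃ c, ∀ x ∈ r, ∀ c', R x w c' → c' = c := fun w => by
    by_cases h : ∃ x ∈ r, ∃ c, R x w c
    · obtain ⟨x, hx, c, -, hc, S, hS, hSU, hxS, hcS⟩ := h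
      refine ⟨c, fun x' hx' c' ⟨_, hc', S', hS', hSU', hxS', hcS'⟩ => ?_⟩
      exact center_unique hp hloc hfin hΩ0 (hU w).1 hΩP (hU w).2.1 (hU w).2.2 hr hrΩ hx' hx
        hS' hS hSU' hSU hxS' hxS hcS' hcS hc' hc
    · exact ⟨x, fun x' hx' c' hc' => absurd ⟨x', hx', c', hc'⟩ h⟩
  choose c hc using hcenter
  refine hr.dist_le_of_subset_biUnion_closedBall (c := c) (fun z hz => ?_) hx hy
  obtain ⟨w, hw, c', hR⟩ := hex z
  refine mem_iUnion₂.2 ⟨w, hw, ?_⟩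
  rw [← hc w z hz c' hR]
  exact hR.1

theorem uniformContinuous_circleExp : UniformContinuous Circle.exp := by
  refine (LipschitzWith.of_dist_le_mul (K := 1) fun a b => ?_).uniformContinuous
  have h : (Circle.exp a : ℂ) - Circle.exp b
      = Circle.exp b * (Complex.exp (Complex.I * ((a - b : ℝ) : ℂ)) - 1) := by
    rw [mul_sub, mul_one, Circle.coe_exp, Circle.coe_exp, ← Complex.exp_add]
    congr 2
    push_cast
    ring
  have hdist : dist (Circle.exp a) (Circle.exp b) = ‖(Circle.exp a : ℂ) - Circle.exp b‖ :=
    dist_eq_norm (Circle.exp a : ℂ) _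
  rw [hdist, h, norm_mul, Circle.norm_coe, one_mul, NNReal.coe_one,
    one_mul, dist_eq_norm]
  exact Real.norm_exp_I_mul_ofReal_sub_one_le

theorem finite_preimage_iterate {X : Type*} {f : X → X} (hfin : ∀ y, (f ⁻¹' {y}).Finite) (m : ℕ) :
    ∀ y, (f^[m] ⁻¹' {y}).Finite := by
  induction m with
  | zero => exact fun y => finite_singleton y
  | succ m ih =>
    exact fun y => ((ih y).biUnion fun z _ => hfin z).subset fun x hx =>
      mem_iUnion₂.2 ⟨f x, hx, rfl⟩

/-- Let `f` be a covering away from the finite forward invariant set `P`, and let an iterate of `f` be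
a factor of `z ↦ z ^ d` on the circle. Then the connected sets that `f^[m]` maps into a convex region
`Ω` disjoint from `P` are uniformly small for large `m`. -/
theorem eventually_dist_le {f : S2 → S2} (hf : Continuous f) (hfin : ∀ y, (f ⁻¹' {y}).Finite)
    {P : Set S2} (hP : P.Finite) (hfP : MapsTo f P P) (hloc : IsLocalHomeomorphOn f (f ⁻¹' Pᶜ))
    {n : ℕ} (hn : 1 ≤ n) {γ : Circle → S2} (hγ : Continuous γ) (hγ_onto : Function.Surjective γ)
    {d : ℕ} (hd : 2 ≤ d) (hsemi : ∀ z, f^[n] (γ z) = γ (z ^ d))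
    {Ω : ConvexCone ℝ E3} (hΩ0 : (0 : E3) ∉ Ω) (hΩP : ∀ b : S2, (b : E3) ∈ Ω → b ∉ P)
    {ε : ℝ} (hε : 0 < ε) :
    ∀ᶠ m in atTop, ∀ r : Set S2, IsPreconnected r → (∀ x ∈ r, (f^[m] x : E3) ∈ Ω) →
      ∀ x ∈ r, ∀ y ∈ r, dist x y ≤ ε := by
  have hlocm : ∀ m, IsLocalHomeomorphOn f^[m] (f^[m] ⁻¹' Pᶜ) := fun m => by
    induction m with
    | zero => exact (Homeomorph.refl S2).isLocalHomeomorph.isLocalHomeomorphOn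
    | succ m ih =>
      refine ih.comp (hloc.mono fun x hx hfx => hx ?_) fun x hx => hx
      exact hfP.iterate m hfx
  have hsemik : ∀ k z, f^[n * k] (γ z) = γ (z ^ d ^ k) := fun k => by
    induction k with
    | zero => simp
    | succ k ih =>
      intro z
      rw [mul_add, mul_one, Function.iterate_add_apply, hsemi, ih, ← pow_mul, pow_succ']
  let g : ℝ → S2 := γ ∘ Circle.exp
  have hg : UniformContinuous g :=
    (CompactSpace.uniformContinuous_of_continuous hγ).comp uniformContinuous_circleExp
  have hg_onto : Function.Surjective g := hγ_onto.comp Circle.exp_surjective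
  have hpg : ∀ s k u, f^[s + n * k] (g u) = (f^[s] ∘ g) ((d ^ k : ℕ) * u) := fun s k u => by
    rw [Function.iterate_add_apply]
    simp only [g, Function.comp_apply, hsemik, Circle.exp_natCast_mul]
  -- the threshold for iterates congruent to `s` modulo `n`
  have key : ∀ s, ∃ K, ∀ k ≥ K, ∀ r : Set S2, IsPreconnected r →
      (∀ x ∈ r, (f^[s + n * k] x : E3) ∈ Ω) → ∀ x ∈ r, ∀ y ∈ r, dist x y ≤ ε := fun s => by
    obtain ⟨t, U, hU, htU⟩ := exists_finite_caps ((hf.iterate s).comp hg.continuous) hP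
      (2 * Real.pi)
    obtain ⟨δ, hδ, hgδ⟩ := Metric.uniformContinuous_iff.1 hg (ε / (2 * t.card + 1)) (by positivity)
    obtain ⟨K, hK⟩ := exists_nat_one_div_lt hδ
    refine ⟨K, fun k hk r hr hrΩ x hx y hy => ?_⟩
    have hdk : (K + 1 : ℝ) ≤ (d ^ k : ℕ) := by
      exact_mod_cast hk.trans_lt ((Nat.lt_two_pow_self).trans_le (Nat.pow_le_pow_left hd k))
    have hD : (0 : ℝ) < (d ^ k : ℕ) := lt_of_lt_of_le (by positivity) hdk
    refine (dist_le_of_finite_caps (hf.iterate _) (hlocm _) (finite_preimage_iterate hfin _)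
      hg.continuous hg_onto hD Real.two_pi_pos ?_ (hpg s k) hU htU (ε := ε / (2 * t.card + 1)) ?_ hΩ0 hΩP hr hrΩ hx
      hy).trans ?_
    · exact (Circle.periodic_exp.comp γ).comp f^[s]
    · intro u u' h
      refine (hgδ ?_).le
      rw [dist_comm, Real.dist_eq]
      exact (h.trans (one_div_le_one_div_of_le (by positivity) hdk)).trans_lt hK
    · rw [← mul_assoc, mul_div_assoc', div_le_iff₀ (by positivity)]
      nlinarith
  choose K hK using key
  filter_upwards [eventually_ge_atTop (n * (Finset.range n).sup K)] with m hm r hr hrΩ x hx y hy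
  have hmod : m % n + n * (m / n) = m := Nat.mod_add_div m n
  refine hK (m % n) (m / n) ?_ r hr (by rwa [hmod]) x hx y hy
  calc K (m % n) ≤ (Finset.range n).sup K :=
        Finset.le_sup (Finset.mem_range.2 (Nat.mod_lt m hn))
    _ ≤ m / n := (Nat.le_div_iff_mul_le hn).2 (by rwa [mul_comm])

/-! ### Topology of branched covers -/

/-- The defining formula `ψ ∘ f = φ ^ q` of the local degree, in terms of points of the sphere. -/
theorem HasLocalDegree.exists_charts {f : S2 → S2} {v : S2} {q : ℕ} (h : HasLocalDegree f v q) :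
    ∃ φ ψ : OpenPartialHomeomorph S2 ℂ, IsDiskChartAt φ v ∧ IsDiskChartAt ψ (f v) ∧
      (∀ x ∈ φ.source, f x ∈ ψ.source ∧ ψ (f x) = φ x ^ q) := by
  obtain ⟨-, φ, ψ, hφ, hψ, hmaps, hz⟩ := h
  refine ⟨φ, ψ, hφ, hψ, fun x hx => ⟨hmaps hx, ?_⟩⟩
  have := hz (φ x) (hφ.target_eq ▸ φ.map_source hx)
  rwa [φ.left_inv hx] at this

namespace IsBranchedCover

variable {f : S2 → S2}

theorem continuous (hf : IsBranchedCover f) : Continuous f := by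
  refine continuous_iff_continuousAt.2 fun v => ?_
  obtain ⟨q, hq⟩ := hf v
  obtain ⟨φ, ψ, hφ, hψ, h⟩ := hq.exists_charts
  have hv := h v hφ.mem_source
  have hcont : ContinuousAt (fun x => ψ.symm (φ x ^ q)) v := by
    refine ContinuousAt.comp (g := ψ.symm) ?_ ((φ.continuousAt hφ.mem_source).pow q)
    rw [← hv.2]
    exact ψ.continuousAt_symm (ψ.map_source hv.1)
  refine hcont.congr ?_
  filter_upwards [φ.open_source.mem_nhds hφ.mem_source] with x hx
  rw [← (h x hx).2, ψ.left_inv (h x hx).1]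

theorem finite_preimage (hf : IsBranchedCover f) (y : S2) : (f ⁻¹' {y}).Finite := by
  refine (isClosed_singleton.preimage hf.continuous).isCompact.finite ?_
  refine isDiscrete_iff_forall_mem_exists_isOpen.mpr fun v hv => ?_
  obtain ⟨q, hq⟩ := hf v
  obtain ⟨φ, ψ, hφ, hψ, h⟩ := hq.exists_charts
  refine ⟨φ.source, φ.open_source, Subset.antisymm (fun x hx => ?_)
    (singleton_subset_iff.2 ⟨hφ.mem_source, hv⟩)⟩
  have hxv : f x = f v := (mem_singleton_iff.1 hx.2).trans (mem_singleton_iff.1 hv).symm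
  have h1 : φ x ^ q = 0 := by rw [← (h x hx.1).2, hxv, hψ.map_zero]
  have h2 : φ x = φ v := by rw [hφ.map_zero]; exact eq_zero_of_pow_eq_zero h1
  exact φ.injOn hx.1 hφ.mem_source h2

theorem isLocalHomeomorphOn (hf : IsBranchedCover f) : IsLocalHomeomorphOn f (crit f)ᶜ := by
  refine IsLocalHomeomorphOn.mk f _ fun v hv => ?_
  obtain ⟨q, hq⟩ := hf v
  have hq1 : q = 1 := by
    have h1 := hq.1
    have h2 : ¬ 2 ≤ q := fun h => hv ⟨q, h, hq⟩
    omega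
  obtain ⟨φ, ψ, hφ, hψ, h⟩ := hq.exists_charts
  have hmem : ∀ x ∈ φ.source, x ∈ (φ.trans ψ.symm).source := fun x hx => by
    rw [φ.trans_source]
    refine ⟨hx, ?_⟩
    rw [mem_preimage, ψ.symm_source, hψ.target_eq, ← hφ.target_eq]
    exact φ.map_source hx
  refine ⟨φ.trans ψ.symm, hmem v hφ.mem_source, fun x hx => ?_⟩
  have hxφ : x ∈ φ.source := by rw [φ.trans_source] at hx; exact hx.1
  have h2 := (h x hxφ).2
  rw [hq1, pow_one] at h2
  rw [OpenPartialHomeomorph.coe_trans, Function.comp_apply, ← h2, ψ.left_inv (h x hxφ).1]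

theorem exists_ne_of_crit_nonempty (hc : (crit f).Nonempty) : ∃ a b, a ≠ b ∧ f a = f b := by
  obtain ⟨c, q, hq2, hq⟩ := hc
  obtain ⟨φ, ψ, hφ, hψ, h⟩ := hq.exists_charts
  have hprim := Complex.isPrimitiveRoot_exp q (by omega)
  set ζ := Complex.exp (2 * Real.pi * Complex.I / q)
  have hζ1 : ζ ≠ 1 := hprim.ne_one hq2
  have hζn : ‖ζ‖ = 1 := hprim.norm'_eq_one (by omega)
  have hmem : ∀ z : ℂ, ‖z‖ = 1 → z / 2 ∈ φ.target := fun z hz => by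
    rw [hφ.target_eq, mem_ball_zero_iff, norm_div, hz]
    norm_num
  have hm1 := hmem 1 norm_one
  have hmζ := hmem ζ hζn
  refine ⟨φ.symm (1 / 2), φ.symm (ζ / 2), fun heq => hζ1 ?_, ?_⟩
  · have := φ.symm.injOn (by exact hm1) (by exact hmζ) heq
    have h2 : (1 : ℂ) = ζ := by
      have h3 := congrArg (· * 2) this
      simpa using h3
    exact h2.symm
  · obtain ⟨h1s, h1⟩ := h _ (φ.map_target hm1)
    obtain ⟨h2s, h2⟩ := h _ (φ.map_target hmζ)
    refine ψ.injOn h1s h2s ?_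
    rw [h1, h2, φ.right_inv hm1, φ.right_inv hmζ, div_pow, div_pow, hprim.pow_eq_one, one_pow]

end IsBranchedCover

theorem mapsTo_post (f : S2 → S2) : MapsTo f (post f) (post f) := by
  rintro _ ⟨n, hn, c, hc, rfl⟩
  exact ⟨n + 1, by omega, c, hc, Function.iterate_succ_apply' f n c⟩

theorem preimage_compl_post_subset (f : S2 → S2) : f ⁻¹' (post f)ᶜ ⊆ (crit f)ᶜ :=
  fun x hx hc => hx ⟨1, le_rfl, x, hc, rfl⟩

theorem crit_nonempty_of_post_nonempty {f : S2 → S2} (h : (post f).Nonempty) :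
    (crit f).Nonempty := by
  obtain ⟨_, n, -, c, hc, -⟩ := h
  exact ⟨c, hc⟩

instance : Infinite S2 := by
  have : (Metric.sphere (0 : E3) 1).Infinite := by
    have hc : IsPreconnected (Metric.sphere (0 : E3) 1) :=
      isPreconnected_sphere (by
        rw [← Module.finrank_eq_rank, finrank_euclideanSpace_fin]; norm_num) _ _
    have hnt : (Metric.sphere (0 : E3) 1).Nontrivial :=
      ⟨EuclideanSpace.single 0 1, by simp, EuclideanSpace.single 1 1, by simp, fun h => by
        have := congrArg (fun v : E3 => v 0) h
        simp at this⟩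
    exact hc.infinite_of_nontrivial hnt
  exact this.to_subtype

/-- A non-injective map `F` with finite fibres that is semiconjugate to `z ↦ z ^ degree F` has degree
at least `2`. If the cardinality of the fibres were unbounded, then `degree F` would be `0` by the
conventions for suprema, and `F` would be constant, against the finiteness of its fibres. -/
theorem two_le_degree {F : S2 → S2} (hfin : ∀ y, (F ⁻¹' {y}).Finite)
    (hne : ∃ a b, a ≠ b ∧ F a = F b) {γ : Circle → S2} (hγ : Function.Surjective γ)
    (hsemi : ∀ z, F (γ z) = γ (z ^ degree F)) : 2 ≤ degree F := by
  by_cases hbdd : BddAbove (range fun w => (F ⁻¹' {w}).ncard)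
  · obtain ⟨a, b, hab, hF⟩ := hne
    refine le_trans ?_ (le_ciSup hbdd (F b))
    exact (one_lt_ncard_iff (hfin _)).2 ⟨a, b, hF, rfl, hab⟩
  · have h0 : degree F = 0 := Nat.iSup_of_not_bddAbove hbdd
    refine absurd (hfin (γ 1)) ?_
    have : F ⁻¹' {γ 1} = univ := eq_univ_of_forall fun x => by
      obtain ⟨z, rfl⟩ := hγ x
      rw [mem_preimage, hsemi, h0, pow_zero, mem_singleton_iff]
    rw [this]
    exact infinite_univ

/-! ### A Jordan curve through finitely many points -/

/-- The homeomorphism of the sphere induced by a linear isometry. -/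
noncomputable def sphereHomeomorph (L : E3 ≃ₗᵢ[ℝ] E3) : S2 ≃ₜ S2 where
  toFun x := ⟨L x, by simp⟩
  invFun x := ⟨L.symm x, by simp⟩
  left_inv x := by simp
  right_inv x := by simp
  continuous_toFun := by fun_prop
  continuous_invFun := by fun_prop

/-- The map that rotates the point `x` of the sphere about the third axis by the angle `θ (x 2)`,
which depends on the latitude. -/
noncomputable def twistFun (θ : ℝ → ℝ) (x : S2) : S2 :=
  ⟨!₂[Real.cos (θ ((x : E3) 2)) * (x : E3) 0 - Real.sin (θ ((x : E3) 2)) * (x : E3) 1,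
      Real.sin (θ ((x : E3) 2)) * (x : E3) 0 + Real.cos (θ ((x : E3) 2)) * (x : E3) 1,
      (x : E3) 2], by
    have hx : ‖(x : E3)‖ = 1 := by simp
    rw [EuclideanSpace.norm_eq, Real.sqrt_eq_one, Fin.sum_univ_three] at hx
    rw [mem_sphere_zero_iff_norm, EuclideanSpace.norm_eq, Real.sqrt_eq_one, Fin.sum_univ_three]
    simp only [Real.norm_eq_abs, sq_abs] at hx ⊢
    simp
    linear_combination hx + ((x : E3) 0 ^ 2 + (x : E3) 1 ^ 2) *
      Real.sin_sq_add_cos_sq (θ ((x : E3) 2))⟩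

theorem continuous_twistFun {θ : ℝ → ℝ} (hθ : Continuous θ) : Continuous (twistFun θ) := by
  refine Continuous.subtype_mk ((PiLp.continuous_toLp 2 _).comp (continuous_pi fun i => ?_)) _
  fin_cases i <;> simp <;> fun_prop

theorem twistFun_neg_twistFun (θ : ℝ → ℝ) (x : S2) : twistFun (-θ) (twistFun θ x) = x := by
  apply Subtype.ext
  ext i
  have h := Real.sin_sq_add_cos_sq (θ ((x : E3) 2))
  fin_cases i
  · simp [twistFun]
    linear_combination (x : E3) 0 * h
  · simp [twistFun]
    linear_combination (x : E3) 1 * h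
  · simp [twistFun]

/-- The latitude-dependent rotation as a homeomorphism of the sphere. -/
noncomputable def twist (θ : ℝ → ℝ) (hθ : Continuous θ) : S2 ≃ₜ S2 where
  toFun := twistFun θ
  invFun := twistFun (-θ)
  left_inv := twistFun_neg_twistFun θ
  right_inv x := by simpa using twistFun_neg_twistFun (-θ) x
  continuous_toFun := continuous_twistFun hθ
  continuous_invFun := continuous_twistFun hθ.neg

/-- A finite set of points of the sphere can be moved to a great circle by a homeomorphism: rotate so
that the points have different latitudes, and then rotate each latitude separately. -/
theorem exists_homeomorph_great_circle {P : Set S2} (hP : P.Finite) :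
    ∃ h : S2 ≃ₜ S2, ∀ x ∈ P, (h x : E3) 1 = 0 := by
  have := hP.to_subtype
  obtain ⟨e, he⟩ := Module.Dual.exists_forall_ne_zero_of_forall_exists
    (fun q : {q : P × P // q.1 ≠ q.2} =>
      (innerₗ E3 ((q.1.1 : S2) - (q.1.2 : S2) : E3) : E3 →ₗ[ℝ] ℝ))
    fun q => ⟨((q.1.1 : S2) - (q.1.2 : S2) : E3), by
      simp only [innerₗ_apply_apply, ne_eq, inner_self_eq_zero, sub_eq_zero]
      exact fun h => q.2 (Subtype.ext (Subtype.ext h))⟩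
  obtain ⟨b, hb⟩ := Orthonormal.exists_orthonormalBasis_extension_of_card_eq (𝕜 := ℝ) (E := E3)
    (ι := Fin 3) (by simp) (v := fun _ => (radial e : E3)) (s := {2})
    (by
      rw [orthonormal_iff_ite]
      rintro ⟨i, rfl⟩ ⟨j, rfl⟩
      simp)
  have hlat : InjOn (fun x : S2 => b.repr x 2) P := by
    intro x hx y hy hxy
    by_contra hne
    have h1 := he ⟨(⟨x, hx⟩, ⟨y, hy⟩), fun h => hne (congrArg Subtype.val h)⟩
    have he0 : e ≠ 0 := fun h => h1 (by simp [h])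
    apply h1
    simp only [b.repr_apply_apply, hb 2 rfl, coe_radial he0, real_inner_smul_left] at hxy
    have h2 := mul_left_cancel₀ (inv_ne_zero (norm_ne_zero_iff.2 he0)) hxy
    simp only [innerₗ_apply_apply]
    rw [real_inner_comm, inner_sub_right, h2, sub_self]
  let α : S2 → ℝ := fun x => -Complex.arg ⟨b.repr x 0, b.repr x 1⟩
  let θ := Lagrange.interpolate hP.toFinset (fun x : S2 => b.repr x 2) α
  refine ⟨(sphereHomeomorph b.repr).trans (twist (fun t => θ.eval t) θ.continuous),
    fun x hx => ?_⟩
  have hθ : θ.eval (b.repr x 2) = α x :=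
    Lagrange.eval_interpolate_at_node α (by simpa using hlat) (hP.mem_toFinset.2 hx)
  have h0 := Complex.norm_mul_cos_arg ⟨b.repr x 0, b.repr x 1⟩
  have h1 := Complex.norm_mul_sin_arg ⟨b.repr x 0, b.repr x 1⟩
  change Real.sin (θ.eval (b.repr x 2)) * b.repr x 0 + Real.cos (θ.eval (b.repr x 2)) * b.repr x 1
    = 0
  simp only [hθ, α, Real.sin_neg, Real.cos_neg]
  simp only at h0 h1
  linear_combination
    Real.sin (Complex.arg ⟨b.repr x 0, b.repr x 1⟩) * h0 -
      Real.cos (Complex.arg ⟨b.repr x 0, b.repr x 1⟩) * h1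

theorem isJordanCurve_preimage_great_circle (h : S2 ≃ₜ S2) :
    IsJordanCurve {x | (h x : E3) 1 = 0} := by
  let c : Circle → S2 := fun z => ⟨!₂[(z : ℂ).re, 0, (z : ℂ).im], by
    have hz := Circle.normSq_coe z
    rw [Complex.normSq_apply] at hz
    rw [mem_sphere_zero_iff_norm, EuclideanSpace.norm_eq, Real.sqrt_eq_one, Fin.sum_univ_three]
    simp
    linarith⟩
  have hc : Continuous c := by
    refine Continuous.subtype_mk ((PiLp.continuous_toLp 2 _).comp (continuous_pi fun i => ?_)) _
    fin_cases i <;> simp <;> fun_prop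
  refine ⟨h.symm ∘ c, h.symm.continuous.comp hc, h.symm.injective.comp fun z w hzw => ?_, ?_⟩
  · have h0 := congrArg (fun x : S2 => (x : E3) 0) hzw
    have h2 := congrArg (fun x : S2 => (x : E3) 2) hzw
    simp [c] at h0 h2
    exact Circle.ext (Complex.ext h0 h2)
  · refine Subset.antisymm ?_ fun x hx => ?_
    · rintro _ ⟨z, rfl⟩
      simp [c]
    · have hn : ‖(h x : E3)‖ = 1 := by simp
      rw [EuclideanSpace.norm_eq, Real.sqrt_eq_one, Fin.sum_univ_three] at hn
      simp only [Real.norm_eq_abs, sq_abs] at hn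
      have hx1 : (h x : E3) 1 = 0 := hx
      have hz : (⟨(h x : E3) 0, (h x : E3) 2⟩ : ℂ) ∈ Submonoid.unitSphere ℂ := by
        rw [Submonoid.unitSphere, ← SetLike.mem_coe]
        change _ ∈ Metric.sphere (0 : ℂ) 1
        rw [mem_sphere_zero_iff_norm, ← sq_eq_sq₀ (norm_nonneg _) zero_le_one,
          Complex.sq_norm, Complex.normSq_apply]
        simp only
        rw [hx1] at hn
        linarith
      obtain ⟨w, hw0, hw2⟩ : ∃ w : Circle, (w : ℂ).re = (h x : E3) 0 ∧ (w : ℂ).im = (h x : E3) 2 :=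
        ⟨(⟨_, hz⟩ : Submonoid.unitSphere ℂ), rfl, rfl⟩
      refine ⟨w, (Homeomorph.symm_apply_eq h).2 (Subtype.ext ?_)⟩
      ext i
      fin_cases i
      · simp [c, hw0]
      · simp [c, hx1]
      · simp [c, hw2]

/-! ### Expansion -/

theorem mesh_nonneg (A : Set S2) : 0 ≤ mesh A :=
  Real.iSup_nonneg fun _ => Metric.diam_nonneg

theorem theorem1p2 (f : S2 → S2) (hf : IsThurstonMap f)
    (n : ℕ) (hn : 1 ≤ n)
    (γ : Circle → S2) (hγ : Continuous γ) (hγ_onto : Function.Surjective γ)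
    (hsemi : ∀ z : Circle, f^[n] (γ z) = γ (z ^ degree (f^[n]))) :
    IsExpanding f := by
  have hbc := hf.isBranchedCover
  have hfc : Continuous f := hbc.continuous
  have hpost : (post f).Nonempty := by
    rw [nonempty_iff_ne_empty]
    intro h
    have := hf.three_le_card_post
    simp [h] at this
  have hdeg : 2 ≤ degree f^[n] := by
    obtain ⟨a, b, hab, hfab⟩ :=
      IsBranchedCover.exists_ne_of_crit_nonempty (crit_nonempty_of_post_nonempty hpost)
    obtain ⟨k, rfl⟩ : ∃ k, n = k + 1 := ⟨n - 1, by omega⟩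
    exact two_le_degree (finite_preimage_iterate hbc.finite_preimage _)
      ⟨a, b, hab, congrArg f^[k] hfab⟩ hγ_onto hsemi
  obtain ⟨h, hh⟩ := exists_homeomorph_great_circle hf.finite_post
  -- the conjugate map, whose postcritical points lie on the great circle `x 1 = 0`
  let g : S2 → S2 := h ∘ f ∘ h.symm
  have hgf : Function.Semiconj h f g := fun x => by simp [g]
  have hg : Continuous g := h.continuous.comp (hfc.comp h.symm.continuous)
  have hgfin : ∀ y, (g ⁻¹' {y}).Finite := fun y => by
    refine ((hbc.finite_preimage (h.symm y)).image h).subset fun x hx => ?_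
    refine ⟨h.symm x, ?_, h.apply_symm_apply x⟩
    rw [mem_preimage, mem_singleton_iff, Homeomorph.eq_symm_apply]
    exact hx
  have hgP : MapsTo g (h '' post f) (h '' post f) := by
    rintro _ ⟨x, hx, rfl⟩
    exact ⟨f x, mapsTo_post f hx, hgf x⟩
  have hgloc : IsLocalHomeomorphOn g (g ⁻¹' (h '' post f)ᶜ) := by
    refine (h.isLocalHomeomorph.isLocalHomeomorphOn (s := univ)).comp
      (hbc.isLocalHomeomorphOn.comp h.symm.isLocalHomeomorph.isLocalHomeomorphOn ?_)
      (mapsTo_univ _ _)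
    exact fun x hx => preimage_compl_post_subset f fun hp => hx ⟨_, hp, rfl⟩
  have hgsemi : ∀ z, g^[n] ((h ∘ γ) z) = (h ∘ γ) (z ^ degree f^[n]) := fun z => by
    rw [Function.comp_apply, ← (hgf.iterate_right n) (γ z), hsemi, Function.comp_apply]
  refine ⟨{x | (h x : E3) 1 = 0}, isJordanCurve_preimage_great_circle h, hh, ?_⟩
  have key : ∀ l : E3 →L[ℝ] ℝ, (∀ x ∈ post f, l (h x) = 0) → ∀ ε > 0, ∀ᶠ m in atTop,
      ∀ r : Set S2, IsPreconnected r → (∀ x ∈ r, 0 < l (h (f^[m] x))) →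
        ∀ x ∈ r, ∀ y ∈ r, dist x y ≤ ε := fun l hl ε hε => by
    obtain ⟨δ, hδ, hhδ⟩ := Metric.uniformContinuous_iff.1
      (CompactSpace.uniformContinuous_of_continuous h.symm.continuous) ε hε
    have hev := eventually_dist_le hg hgfin (hf.finite_post.image h) hgP hgloc hn
      (h.continuous.comp hγ) (h.surjective.comp hγ_onto) hdeg hgsemi (Ω := posCone l)
      zero_notMem_posCone (by
        rintro _ hb ⟨x, hx, rfl⟩
        exact (mem_posCone.1 hb).ne' (hl x hx)) (half_pos hδ)
    filter_upwards [hev] with m hm r hr hrl x hx y hy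
    have hxy := hm (h '' r) (hr.image h h.continuous.continuousOn) (by
      rintro _ ⟨z, hz, rfl⟩
      rw [← (hgf.iterate_right m) z]
      exact hrl z hz) (h x) ⟨x, hx, rfl⟩ (h y) ⟨y, hy, rfl⟩
    simpa using (hhδ (hxy.trans_lt (half_lt_self hδ))).le
  rw [Metric.tendsto_atTop']
  intro ε hε
  have h₁ := key (EuclideanSpace.proj 1) hh (ε / 2) (half_pos hε)
  have h₂ := key (-EuclideanSpace.proj 1) (fun x hx => neg_eq_zero.2 (hh x hx)) (ε / 2)
    (half_pos hε)
  obtain ⟨M, hM⟩ := eventually_atTop.1 (h₁.and h₂)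
  refine ⟨M, fun m hm => ?_⟩
  obtain ⟨hm₁, hm₂⟩ := hM m hm.le
  rw [Real.dist_0_eq_abs, abs_of_nonneg (mesh_nonneg _)]
  refine lt_of_le_of_lt (Real.iSup_le (fun x => ?_) (half_pos hε).le) (half_lt_self hε)
  set r := connectedComponentIn (f^[m] ⁻¹' {x | (h x : E3) 1 = 0})ᶜ (x : S2)
  have hr : IsPreconnected r := isPreconnected_connectedComponentIn
  have hne : ∀ z ∈ r, (h (f^[m] z) : E3) 1 ≠ 0 := fun z hz =>
    connectedComponentIn_subset _ _ hz
  have himg : OrdConnected ((fun z => (h (f^[m] z) : E3) 1) '' r) := by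
    refine (hr.image _ ?_).ordConnected
    have := hfc.iterate m
    fun_prop
  -- a connected set over the complement of the great circle lies over one of the hemispheres
  have hsign : (∀ z ∈ r, 0 < (h (f^[m] z) : E3) 1) ∨ ∀ z ∈ r, 0 < -(h (f^[m] z) : E3) 1 := by
    by_contra! hcon
    obtain ⟨⟨z, hz, hz'⟩, w, hw, hw'⟩ := hcon
    obtain ⟨v, hv, hv0⟩ := himg.out ⟨z, hz, rfl⟩ ⟨w, hw, rfl⟩ ⟨hz', by simpa using hw'⟩
    exact hne v hv hv0
  refine Metric.diam_le_of_forall_dist_le (half_pos hε).le ?_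
  rcases hsign with hs | hs
  · exact hm₁ r hr hs
  · exact hm₂ r hr hs
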